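/- Let $(\tilde M,\varphi,\xi,\eta,g)$ be a Sasakian manifold, i.e. a normal contact metric manifold: an almost contact metric manifold ($\varphi^2=-I+\eta\otimes\xi$, $\eta(\xi)=1$, $g(\varphi X,\varphi Y)=g(X,Y)-\eta(X)\eta(Y)$) with $d\eta(X,Y)=g(X,\varphi Y)$ and $[\varphi,\varphi]+2\,d\eta\otimes\xi=0$, where $2\,d\eta(X,Y)=X\eta(Y)-Y\eta(X)-\eta([X,Y])$. Let $M=M_T\times_f M_\theta$, with $\dim M_\theta>0$, be a warped product pointwise semi-slant submanifold of $\tilde M$ with $\xi$ tangent to $M_T$. That is: $M_T$ and $M_\theta$ are Riemannian manifolds with metrics $g_T$ and $g_\theta$, $f$ is a positive smooth function on $M_T$, and the product manifold $M=M_T\times M_\theta$ with the metric $g_T+f^2g_\theta$ is isometrically immersed in $\tilde M$; each leaf $M_T\times\{q\}$ is an invariant submanifold ($\varphi$ preserves its tangent spaces) to which $\xi$ is tangent; and each fibre $\{p\}\times M_\theta$ is a pointwise slant submanifold with slant function $\theta(p,\cdot)$, where $\theta:M\to\mathbb R$: for every tangent vector $Z$ of the fibre at $(p,q)$ that is not proportional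 to $\xi$, the angle between $\varphi Z$ and the tangent space of the fibre is $\theta(p,q)$. Then one of the following holds. 1. $M$ is a contact CR-warped product $M_T\times_f M_\perp$: the fibres $\{p\}\times M_\theta$ are anti-invariant ($\varphi$ maps their tangent spaces into their normal spaces), and $\theta=\frac{\pi}{2}$ on $M$. 2. On all of $M$, $\theta$ is differentiable with $\cos\theta\neq 0$, $X(\ln f)=\tan\theta\,X(\theta)$ for every $X$ tangent to $M_T$, and $\nabla(\ln f)=\tan\theta\,\nabla\theta$, where $\nabla$ denotes the gradient on $M$. -/

import Mathlib

open scoped Manifold ContDiff Bundle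

noncomputable section

/-- A smooth Riemannian metric on the manifold `M`. -/
abbrev SmoothMetric {E H : Type*} [NormedAddCommGroup E] [NormedSpace ℝ E] [TopologicalSpace H]
    (I : ModelWithCorners ℝ E H) (M : Type*) [TopologicalSpace M] [ChartedSpace H M]
    [IsManifold I ∞ M] :=
  Bundle.ContMDiffRiemannianMetric I ∞ E (fun x : M => TangentSpace I x)

section AlmostContact

variable {E H : Type*} [NormedAddCommGroup E] [NormedSpace ℝ E] [TopologicalSpace H]
  (I : ModelWithCorners ℝ E H) (N : Type*) [TopologicalSpace N] [ChartedSpace H N]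
  [IsManifold I ∞ N]

/-- An almost contact metric structure `(φ, ξ, η, g)` on the manifold `N`. -/
structure AlmostContactMetric where
  /-- the `(1,1)` tensor field -/
  φ : ∀ x : N, TangentSpace I x →L[ℝ] TangentSpace I x
  /-- the characteristic (Reeb) vector field -/
  ξ : ∀ x : N, TangentSpace I x
  /-- the 1-form -/
  η : ∀ x : N, TangentSpace I x →L[ℝ] ℝ
  /-- the compatible Riemannian metric -/
  g : SmoothMetric I N
  smooth_φ : ContMDiff I (I.prod 𝓘(ℝ, E →L[ℝ] E)) ∞
    (fun x => Bundle.TotalSpace.mk' (E →L[ℝ] E)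
      (E := fun x : N => TangentSpace I x →L[ℝ] TangentSpace I x) x (φ x))
  smooth_ξ : ContMDiff I (I.prod 𝓘(ℝ, E)) ∞
    (fun x => Bundle.TotalSpace.mk' E (E := fun x : N => TangentSpace I x) x (ξ x))
  smooth_η : ContMDiff I (I.prod 𝓘(ℝ, E →L[ℝ] ℝ)) ∞
    (fun x => Bundle.TotalSpace.mk' (E →L[ℝ] ℝ)
      (E := fun x : N => TangentSpace I x →L[ℝ] Bundle.Trivial N ℝ x) x (η x))
  /-- `φ² = -I + η ⊗ ξ` -/
  φ_sq : ∀ (x : N) (v : TangentSpace I x), φ x (φ x v) = -v + η x v • ξ x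
  /-- `η(ξ) = 1` -/
  η_ξ : ∀ x : N, η x (ξ x) = 1
  /-- `η ∘ φ = 0` -/
  η_φ : ∀ (x : N) (v : TangentSpace I x), η x (φ x v) = 0
  /-- `g(φX, φY) = g(X, Y) - η(X) η(Y)` -/
  compat : ∀ (x : N) (v w : TangentSpace I x),
    g.inner x (φ x v) (φ x w) = g.inner x v w - η x v * η x w

variable {I N}

/-- The vector field `X`, seen as a section of the tangent bundle, is smooth at `x`. -/
def SmoothFieldAt (X : ∀ y : N, TangentSpace I y) (x : N) : Prop :=
  ContMDiffAt I (I.prod 𝓘(ℝ, E)) ∞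
    (fun y => Bundle.TotalSpace.mk' E (E := fun y : N => TangentSpace I y) y (X y)) x

namespace AlmostContactMetric

/-- The exterior derivative of `η`, evaluated on two vector fields:
`dη(X, Y) = (X(η(Y)) - Y(η(X)) - η([X, Y])) / 2`. -/
def dη (S : AlmostContactMetric I N) (X Y : ∀ y : N, TangentSpace I y) (x : N) : ℝ :=
  (mvfderiv I (fun y => S.η y (Y y)) x (X x) - mvfderiv I (fun y => S.η y (X y)) x (Y x)
    - S.η x (VectorField.mlieBracket I X Y x)) / 2

/-- The Nijenhuis torsion of `φ`, evaluated on two vector fields: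
`[φ, φ](X, Y) = φ²[X, Y] + [φX, φY] - φ[φX, Y] - φ[X, φY]`. -/
def nijenhuis (S : AlmostContactMetric I N) (X Y : ∀ y : N, TangentSpace I y) (x : N) :
    TangentSpace I x :=
  S.φ x (S.φ x (VectorField.mlieBracket I X Y x))
    + VectorField.mlieBracket I (fun y => S.φ y (X y)) (fun y => S.φ y (Y y)) x
    - S.φ x (VectorField.mlieBracket I (fun y => S.φ y (X y)) Y x)
    - S.φ x (VectorField.mlieBracket I X (fun y => S.φ y (Y y)) x)

/-- A Sasakian structure is a normal contact metric structure. -/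
structure IsSasakian (S : AlmostContactMetric I N) : Prop where
  /-- contact metric: `dη(X, Y) = g(X, φY)` -/
  contact : ∀ (x : N) (X Y : ∀ y : N, TangentSpace I y), SmoothFieldAt X x → SmoothFieldAt Y x →
    S.dη X Y x = S.g.inner x (X x) (S.φ x (Y x))
  /-- normal: `[φ, φ] + 2 dη ⊗ ξ = 0` -/
  normal : ∀ (x : N) (X Y : ∀ y : N, TangentSpace I y), SmoothFieldAt X x → SmoothFieldAt Y x →
    S.nijenhuis X Y x + (2 * S.dη X Y x) • S.ξ x = 0

end AlmostContactMetric

/-- The angle (in `[0, π]`) between two nonzero tangent vectors. -/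
def SmoothMetric.angle (g : SmoothMetric I N) (x : N) (u w : TangentSpace I x) : ℝ :=
  Real.arccos (g.inner x u w / (√(g.inner x u u) * √(g.inner x w w)))

/-- The angle between a nonzero tangent vector `u` and a nonzero subspace `W` of the tangent space:
the smallest angle between `u` and a nonzero vector of `W`. -/
def SmoothMetric.angleSubspace (g : SmoothMetric I N) (x : N) (u : TangentSpace I x)
    (W : Submodule ℝ (TangentSpace I x)) : ℝ :=
  sInf {a : ℝ | ∃ w ∈ W, w ≠ 0 ∧ a = SmoothMetric.angle g x u w}

end AlmostContact

section Immersed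

variable {E H : Type*} [NormedAddCommGroup E] [NormedSpace ℝ E] [TopologicalSpace H]
  {I : ModelWithCorners ℝ E H} {N : Type*} [TopologicalSpace N] [ChartedSpace H N]
  [IsManifold I ∞ N]
  {E' H' : Type*} [NormedAddCommGroup E'] [NormedSpace ℝ E'] [TopologicalSpace H']
  (I' : ModelWithCorners ℝ E' H') {L : Type*} [TopologicalSpace L] [ChartedSpace H' L]

/-- The tangent space at `p` of the submanifold of `N` given by the immersion `j : L → N`, as a
subspace of the tangent space of `N` at `j p`. -/
def tangentRange (I : ModelWithCorners ℝ E H) (j : L → N) (p : L) :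
    Submodule ℝ (TangentSpace I (j p)) :=
  LinearMap.range (mfderiv I' I j p).toLinearMap

/-- The immersed submanifold `j : L → N` is invariant: `φ` maps its tangent spaces to
themselves. -/
def IsInvariantSubmanifold (S : AlmostContactMetric I N) (j : L → N) : Prop :=
  ∀ (p : L), ∀ u ∈ tangentRange I' I j p, S.φ (j p) u ∈ tangentRange I' I j p

/-- The immersed submanifold `j : L → N` is anti-invariant: `φ` maps its tangent spaces into its
normal spaces. -/
def IsAntiInvariantSubmanifold (S : AlmostContactMetric I N) (j : L → N) : Prop :=
  ∀ (p : L), ∀ u ∈ tangentRange I' I j p, ∀ w ∈ tangentRange I' I j p,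
    S.g.inner (j p) (S.φ (j p) u) w = 0

/-- The immersed submanifold `j : L → N` is pointwise slant with slant function `θ`: for every
tangent vector `u` at `p` that is not proportional to `ξ`, the angle between `φ u` and the tangent
space of the submanifold at `p` is `θ p`. -/
def IsPointwiseSlant (S : AlmostContactMetric I N) (j : L → N) (θ : L → ℝ) : Prop :=
  ∀ (p : L), ∀ u ∈ tangentRange I' I j p, u ∉ Submodule.span ℝ {S.ξ (j p)} →
    SmoothMetric.angleSubspace S.g (j p) (S.φ (j p) u) (tangentRange I' I j p) = θ p

end Immersed

section Gradient

variable {E H : Type*} [NormedAddCommGroup E] [NormedSpace ℝ E]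
  [TopologicalSpace H] {I : ModelWithCorners ℝ E H} {M : Type*} [TopologicalSpace M]
  [ChartedSpace H M] [IsManifold I ∞ M]

/-- The linear map `v ↦ g(v, ·)` from a tangent space to its dual. -/
def SmoothMetric.flat (g : SmoothMetric I M) (x : M) : E →ₗ[ℝ] Module.Dual ℝ E where
  toFun v := (g.inner x v : E →L[ℝ] ℝ).toLinearMap
  map_add' v w := by
    apply LinearMap.ext
    intro u
    have h : g.inner x (v + w : TangentSpace I x) = g.inner x v + g.inner x w := map_add _ _ _
    exact congrArg (fun k : TangentSpace I x →L[ℝ] ℝ => k u) h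
  map_smul' c v := by
    apply LinearMap.ext
    intro u
    have h : g.inner x (c • v : TangentSpace I x) = c • g.inner x v := map_smul _ _ _
    exact congrArg (fun k : TangentSpace I x →L[ℝ] ℝ => k u) h

theorem SmoothMetric.flat_injective (g : SmoothMetric I M) (x : M) :
    Function.Injective (SmoothMetric.flat g x) := by
  rw [injective_iff_map_eq_zero]
  intro v hv
  by_contra hne
  have h0 : g.inner x v v = 0 := congrArg (fun k : Module.Dual ℝ E => k v) hv
  exact absurd h0 (g.pos x v hne).ne'

/-- The gradient at `x` of a real function `h`: the tangent vector `v` with `g(v, w) = dh(w)` for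
all `w`. -/
def SmoothMetric.grad [FiniteDimensional ℝ E] (g : SmoothMetric I M) (h : M → ℝ) (x : M) :
    TangentSpace I x :=
  (LinearMap.linearEquivOfInjective (SmoothMetric.flat g x) (SmoothMetric.flat_injective g x)
    Subspace.dual_finrank_eq.symm).symm (mvfderiv I h x : E →L[ℝ] ℝ).toLinearMap

theorem SmoothMetric.inner_grad [FiniteDimensional ℝ E] (g : SmoothMetric I M) (h : M → ℝ)
    (x : M) (w : TangentSpace I x) :
    g.inner x (SmoothMetric.grad g h x) w = mvfderiv I h x w := by
  have key := LinearEquiv.apply_symm_apply (LinearMap.linearEquivOfInjective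
    (SmoothMetric.flat g x) (SmoothMetric.flat_injective g x)
    Subspace.dual_finrank_eq.symm) (mvfderiv I h x : E →L[ℝ] ℝ).toLinearMap
  exact congrArg (fun k : Module.Dual ℝ E => k w) key

end Gradient

section Warped

variable {E H : Type*} [NormedAddCommGroup E] [NormedSpace ℝ E] [TopologicalSpace H]
  {I : ModelWithCorners ℝ E H} {N : Type*} [TopologicalSpace N] [ChartedSpace H N]
  [IsManifold I ∞ N]
  {E₁ H₁ : Type*} [NormedAddCommGroup E₁] [NormedSpace ℝ E₁] [TopologicalSpace H₁]
  {I₁ : ModelWithCorners ℝ E₁ H₁} {M₁ : Type*} [TopologicalSpace M₁] [ChartedSpace H₁ M₁]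
  [IsManifold I₁ ∞ M₁]
  {E₂ H₂ : Type*} [NormedAddCommGroup E₂] [NormedSpace ℝ E₂] [TopologicalSpace H₂]
  {I₂ : ModelWithCorners ℝ E₂ H₂} {M₂ : Type*} [TopologicalSpace M₂] [ChartedSpace H₂ M₂]
  [IsManifold I₂ ∞ M₂]

/-- `g` is the metric of the warped product `M₁ ×_f M₂`:
`g(X, Y) = g₁(π₁⋆X, π₁⋆Y) + (f ∘ π₁)² g₂(π₂⋆X, π₂⋆Y)` with `f` smooth and positive on `M₁`. -/
structure IsWarpedProductMetric (g₁ : SmoothMetric I₁ M₁) (g₂ : SmoothMetric I₂ M₂)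
    (f : M₁ → ℝ) (g : SmoothMetric (I₁.prod I₂) (M₁ × M₂)) : Prop where
  smooth_f : ContMDiff I₁ 𝓘(ℝ, ℝ) ∞ f
  pos_f : ∀ p, 0 < f p
  inner_eq : ∀ (x : M₁ × M₂) (v w : TangentSpace (I₁.prod I₂) x),
    g.inner x v w =
      g₁.inner x.1 (mfderiv (I₁.prod I₂) I₁ Prod.fst x v) (mfderiv (I₁.prod I₂) I₁ Prod.fst x w)
      + f x.1 ^ 2 *
        g₂.inner x.2 (mfderiv (I₁.prod I₂) I₂ Prod.snd x v)
          (mfderiv (I₁.prod I₂) I₂ Prod.snd x w)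

/-- `ι` is an isometric immersion. -/
structure IsIsometricImmersion {E' H' : Type*} [NormedAddCommGroup E'] [NormedSpace ℝ E']
    [TopologicalSpace H'] {I' : ModelWithCorners ℝ E' H'} {L : Type*} [TopologicalSpace L]
    [ChartedSpace H' L] [IsManifold I' ∞ L]
    (gL : SmoothMetric I' L) (gN : SmoothMetric I N) (ι : L → N) : Prop where
  smooth : ContMDiff I' I ∞ ι
  isometric : ∀ (x : L) (v w : TangentSpace I' x),
    gN.inner (ι x) (mfderiv I' I ι x v) (mfderiv I' I ι x w) = gL.inner x v w

/-- `ι` makes the warped product `M₁ ×_f M₂` a warped product submanifold of `N` whose leaves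
`M₁ × {q}` are invariant submanifolds to which `ξ` is tangent. -/
structure IsWarpedInvariantBase (S : AlmostContactMetric I N)
    (g₁ : SmoothMetric I₁ M₁) (g₂ : SmoothMetric I₂ M₂) (f : M₁ → ℝ)
    (g : SmoothMetric (I₁.prod I₂) (M₁ × M₂)) (ι : M₁ × M₂ → N) : Prop where
  warped : IsWarpedProductMetric g₁ g₂ f g
  immersion : IsIsometricImmersion g S.g ι
  invariant : ∀ q : M₂, IsInvariantSubmanifold I₁ S (fun p : M₁ => ι (p, q))
  ξ_tangent : ∀ (p : M₁) (q : M₂), S.ξ (ι (p, q)) ∈ tangentRange I₁ I (fun p : M₁ => ι (p, q)) p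

/-- A warped product pointwise semi-slant submanifold `M_T ×_f M_θ` with `ξ` tangent to `M_T`: the
leaves `M_T × {q}` are invariant, and the fibres `{p} × M_θ` are pointwise slant, the slant
function being `θ : M_T × M_θ → ℝ`. -/
structure IsWarpedPointwiseSemiSlant (S : AlmostContactMetric I N)
    (gT : SmoothMetric I₁ M₁) (gθ : SmoothMetric I₂ M₂) (f : M₁ → ℝ)
    (g : SmoothMetric (I₁.prod I₂) (M₁ × M₂)) (ι : M₁ × M₂ → N) (θ : M₁ × M₂ → ℝ) : Prop extends
    IsWarpedInvariantBase S gT gθ f g ι where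
  slant : ∀ p : M₁, IsPointwiseSlant I₂ S (fun q : M₂ => ι (p, q)) (fun q => θ (p, q))

/-- A contact CR-warped product `M_T ×_f M_⊥`: the leaves `M_T × {q}` are invariant and tangent
to `ξ`, and the fibres `{p} × M_⊥` are anti-invariant. -/
structure IsContactCRWarped (S : AlmostContactMetric I N)
    (gT : SmoothMetric I₁ M₁) (gP : SmoothMetric I₂ M₂) (f : M₁ → ℝ)
    (g : SmoothMetric (I₁.prod I₂) (M₁ × M₂)) (ι : M₁ × M₂ → N) : Prop extends
    IsWarpedInvariantBase S gT gP f g ι where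
  antiInvariant : ∀ p : M₁, IsAntiInvariantSubmanifold I₂ S (fun q : M₂ => ι (p, q))

end Warped

end

open Topology

/-! The first alternative always holds. In a warped product the leaves are orthogonal to the fibres,
and `ξ` is tangent to the leaves, so `η = g(ξ, ·)` vanishes on every fibre
(`IsWarpedInvariantBase.η_fibre`). Hence `dη` also pulls back to zero on a fibre, and the contact
condition `dη(X, Y) = g(X, φY)` makes `φY` orthogonal to the fibre for all `X`, `Y` tangent to it.
The fibres are therefore anti-invariant, and the slant angle is `π / 2`.

The work lies in pulling back `dη`, which is defined through vector fields on the ambient manifold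
(`IsSasakian.inner_φ_eq_zero_of_η_eq_zero`). On fields with constant chart coordinates the bracket
term disappears, and `dη` becomes the antisymmetrised derivative of `η` read in the chart.
`fderiv_apply_comm_of_pullback_eq_zero` then kills it, by symmetry of the second derivative of the
immersion. -/

/-! ### Calculus of 1-forms on normed spaces -/

/-- If a 1-form `α` vanishes along the image of the derivative of `F`, then its exterior derivative
vanishes on the image of the derivative of `F`. -/
theorem fderiv_apply_comm_of_pullback_eq_zero
    {E E' : Type*} [NormedAddCommGroup E] [NormedSpace ℝ E]
    [NormedAddCommGroup E'] [NormedSpace ℝ E']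
    {α : E → E →L[ℝ] ℝ} {F : E' → E} {x : E'} (hF : ContDiffAt ℝ 2 F x)
    (hα : DifferentiableAt ℝ α (F x))
    (h : ∀ᶠ z in 𝓝 x, ∀ u, α (F z) (fderiv ℝ F z u) = 0) (u w : E') :
    fderiv ℝ α (F x) (fderiv ℝ F x u) (fderiv ℝ F x w)
      = fderiv ℝ α (F x) (fderiv ℝ F x w) (fderiv ℝ F x u) := by
  have hF' : DifferentiableAt ℝ (fderiv ℝ F) x :=
    (hF.fderiv_right (m := 1) (by norm_num)).differentiableAt (by norm_num)
  have hFx : DifferentiableAt ℝ F x := hF.differentiableAt (by norm_num)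
  have hsymm : IsSymmSndFDerivAt ℝ F x := hF.isSymmSndFDerivAt (by simp)
  -- Differentiate `α (F z) (DF z b) = 0` in the direction `a`. The term containing the second
  -- derivative of `F` is symmetric in `a` and `b`, so the other one must be too.
  have key (a b : E') : α (F x) (fderiv ℝ (fderiv ℝ F) x a b)
      + fderiv ℝ α (F x) (fderiv ℝ F x a) (fderiv ℝ F x b) = 0 := by
    have h0 : (fun z => α (F z) (fderiv ℝ F z b)) =ᶠ[𝓝 x] fun _ => (0 : ℝ) :=
      h.mono fun z hz => hz b
    have h1 := ((hα.hasFDerivAt.comp x hFx.hasFDerivAt).clm_apply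
      (hF'.hasFDerivAt.clm_apply (hasFDerivAt_const b x)))
    have h2 := congrArg (fun k => k a)
      (h1.unique ((hasFDerivAt_const (0 : ℝ) x).congr_of_eventuallyEq h0))
    simpa using h2
  have hs := hsymm u w
  have h1 := key u w
  have h2 := key w u
  rw [hs] at h1
  linarith

/-- In finite dimension `α` is a finite sum of fixed covectors times its values on a basis. This
reduces differentiability of a chart 1-form to its values on constant vectors. -/
theorem differentiableAt_of_forall_apply
    {D E F : Type*} [NormedAddCommGroup D] [NormedSpace ℝ D]
    [NormedAddCommGroup E] [NormedSpace ℝ E] [FiniteDimensional ℝ E]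
    [NormedAddCommGroup F] [NormedSpace ℝ F] {α : D → E →L[ℝ] F} {x : D}
    (h : ∀ a, DifferentiableAt ℝ (fun e => α e a) x) : DifferentiableAt ℝ α x := by
  let b := Module.finBasis ℝ E
  have hα : α = fun e => ∑ i, (b.coord i).toContinuousLinearMap.smulRight (α e (b i)) := by
    funext e
    ext v
    conv_lhs => rw [← b.sum_repr v]
    simp [map_sum, -Module.Basis.sum_repr]
  rw [hα]
  refine DifferentiableAt.fun_sum fun i _ => ?_
  exact (ContinuousLinearMap.smulRightL ℝ E F
    (b.coord i).toContinuousLinearMap).differentiableAt.comp x (h (b i))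

/-! ### Coordinate vector fields -/

section

variable {E : Type*} [NormedAddCommGroup E] [NormedSpace ℝ E]
  {N : Type*} [TopologicalSpace N] [ChartedSpace E N] [IsManifold 𝓘(ℝ, E) ∞ N]

/-- The vector field with constant coordinates `a` in the preferred chart at `y`. -/
noncomputable def chartConstField (y : N) (a : E) (z : N) : TangentSpace 𝓘(ℝ, E) z :=
  VectorField.mpullback 𝓘(ℝ, E) 𝓘(ℝ, E) (extChartAt 𝓘(ℝ, E) y) (fun _ => a) z

theorem smoothFieldAt_chartConstField [CompleteSpace E] (y : N) (a : E) :
    SmoothFieldAt (I := 𝓘(ℝ, E)) (chartConstField y a) y := by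
  have hconst : ContMDiffAt 𝓘(ℝ, E) (𝓘(ℝ, E).prod 𝓘(ℝ, E)) ∞
      (fun z : E => Bundle.TotalSpace.mk' E (E := fun z : E => TangentSpace 𝓘(ℝ, E) z) z a)
      (extChartAt 𝓘(ℝ, E) y y) := by
    exact contMDiffAt_vectorSpace_iff_contDiffAt.2 contDiffAt_const
  exact hconst.mpullback_vectorField_preimage (n := ∞) contMDiffAt_extChartAt
    (isInvertible_mfderiv_extChartAt (mem_extChartAt_source y)) le_rfl

/-- The bracket commutes with pullback by the chart, and constant fields on `E` commute. -/
theorem mlieBracket_chartConstField [CompleteSpace E] (y : N) (a b : E) :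
    VectorField.mlieBracket 𝓘(ℝ, E) (chartConstField y a) (chartConstField y b) y = 0 := by
  have : IsManifold 𝓘(ℝ, E) (minSmoothness ℝ 3) N := by
    rw [minSmoothness_of_isRCLikeNormedField]
    exact IsManifold.of_le (n := ∞) (WithTop.coe_le_coe.2 (le_top : (3 : ℕ∞) ≤ ⊤))
  have hconst (c : E) : MDifferentiableAt 𝓘(ℝ, E) (𝓘(ℝ, E).prod 𝓘(ℝ, E))
      (fun z : E => Bundle.TotalSpace.mk' E (E := fun z : E => TangentSpace 𝓘(ℝ, E) z) z c)
      (extChartAt 𝓘(ℝ, E) y y) := by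
    have : ContMDiffAt 𝓘(ℝ, E) (𝓘(ℝ, E).prod 𝓘(ℝ, E)) 1
      (fun z : E => Bundle.TotalSpace.mk' E (E := fun z : E => TangentSpace 𝓘(ℝ, E) z) z c)
      (extChartAt 𝓘(ℝ, E) y y) := by
      exact contMDiffAt_vectorSpace_iff_contDiffAt.2 contDiffAt_const
    exact this.mdifferentiableAt one_ne_zero
  have h := VectorField.mpullback_mlieBracket (I := 𝓘(ℝ, E)) (I' := 𝓘(ℝ, E)) (n := ∞)
    (hconst a) (hconst b) (contMDiffAt_extChartAt (x := y))
    (by rw [minSmoothness_of_isRCLikeNormedField]; exact WithTop.coe_le_coe.2 (le_top : (2 : ℕ∞) ≤ ⊤))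
  refine h.symm.trans ?_
  have h0 : VectorField.mlieBracket 𝓘(ℝ, E) (fun _ : E => a) (fun _ : E => b) = 0 := by
    refine VectorField.mlieBracketWithin_univ.symm.trans
      (VectorField.mlieBracketWithin_eq_lieBracketWithin.trans ?_)
    funext z
    simp [VectorField.lieBracketWithin]
    rfl
  rw [h0, VectorField.mpullback_zero]
  rfl

theorem mfderiv_extChartAt_chartConstField {y z : N} (hz : z ∈ (extChartAt 𝓘(ℝ, E) y).source)
    (a : E) :
    mfderiv 𝓘(ℝ, E) 𝓘(ℝ, E) (extChartAt 𝓘(ℝ, E) y) z (chartConstField y a z) = a :=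
  (isInvertible_mfderiv_extChartAt hz).self_apply_inverse a

theorem chartConstField_mfderiv_extChartAt {y z : N} (hz : z ∈ (extChartAt 𝓘(ℝ, E) y).source)
    (v : TangentSpace 𝓘(ℝ, E) z) :
    chartConstField (E := E) y (mfderiv 𝓘(ℝ, E) 𝓘(ℝ, E) (extChartAt 𝓘(ℝ, E) y) z v) z = v :=
  (isInvertible_mfderiv_extChartAt hz).inverse_apply_self v

/-! ### The contact form and its exterior derivative in a chart -/

namespace AlmostContactMetric

variable (S : AlmostContactMetric 𝓘(ℝ, E) N)

/-- The 1-form `η` read in the preferred chart at `y`. -/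
noncomputable def chartη (y : N) (e : E) : E →L[ℝ] ℝ :=
  let z := (extChartAt 𝓘(ℝ, E) y).symm e
  (S.η z : E →L[ℝ] ℝ) ∘L
    (mfderiv 𝓘(ℝ, E) 𝓘(ℝ, E) (extChartAt 𝓘(ℝ, E) y) z : E →L[ℝ] E).inverse

theorem chartη_apply (y : N) (e a : E) :
    S.chartη y e a = S.η ((extChartAt 𝓘(ℝ, E) y).symm e)
      (chartConstField y a ((extChartAt 𝓘(ℝ, E) y).symm e)) := rfl

theorem chartη_extChartAt_apply {y z : N} (hz : z ∈ (extChartAt 𝓘(ℝ, E) y).source) (a : E) :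
    S.chartη y (extChartAt 𝓘(ℝ, E) y z) a = S.η z (chartConstField y a z) := by
  rw [chartη_apply, (extChartAt 𝓘(ℝ, E) y).left_inv hz]

theorem contMDiffAt_η_apply {X : ∀ y : N, TangentSpace 𝓘(ℝ, E) y} {y : N}
    (hX : SmoothFieldAt X y) : ContMDiffAt 𝓘(ℝ, E) 𝓘(ℝ, ℝ) ∞ (fun z => S.η z (X z)) y := by
  have h := ContMDiffAt.clm_bundle_apply (F₁ := E) (F₂ := ℝ)
    (E₁ := fun x : N => TangentSpace 𝓘(ℝ, E) x) (E₂ := Bundle.Trivial N ℝ) S.smooth_η.contMDiffAt hX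
  rw [Bundle.contMDiffAt_section] at h
  exact h

theorem differentiableAt_chartη [FiniteDimensional ℝ E] (y : N) :
    DifferentiableAt ℝ (S.chartη y) (extChartAt 𝓘(ℝ, E) y y) := by
  have h (a : E) : DifferentiableAt ℝ (fun e => S.chartη y e a) (extChartAt 𝓘(ℝ, E) y y) := by
    have h1 := S.contMDiffAt_η_apply (smoothFieldAt_chartConstField y a)
    have h2 : ContMDiffAt 𝓘(ℝ, E) 𝓘(ℝ, E) ∞ (extChartAt 𝓘(ℝ, E) y).symm
        (extChartAt 𝓘(ℝ, E) y y) :=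
      (contMDiffOn_extChartAt_symm y).contMDiffAt (extChartAt_target_mem_nhds y)
    have h3 : ContMDiffAt 𝓘(ℝ, E) 𝓘(ℝ, ℝ) ∞ (fun e => S.chartη y e a)
        (extChartAt 𝓘(ℝ, E) y y) := h1.comp_of_eq h2 (extChartAt_to_inv y)
    exact (contMDiffAt_iff_contDiffAt.1 h3).differentiableAt (by simp)
  exact differentiableAt_of_forall_apply h

theorem mvfderiv_η_chartConstField [FiniteDimensional ℝ E] (y : N) (a : E) (v : TangentSpace 𝓘(ℝ, E) y) :
    mvfderiv 𝓘(ℝ, E) (fun z => S.η z (chartConstField y a z)) y v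
      = fderiv ℝ (S.chartη y) (extChartAt 𝓘(ℝ, E) y y)
        (mfderiv 𝓘(ℝ, E) 𝓘(ℝ, E) (extChartAt 𝓘(ℝ, E) y) y v) a := by
  have heq : (fun z => S.η z (chartConstField y a z)) =ᶠ[𝓝 y]
      (fun e => S.chartη y e a) ∘ extChartAt 𝓘(ℝ, E) y := by
    filter_upwards [extChartAt_source_mem_nhds (I := 𝓘(ℝ, E)) y] with z hz
    exact (S.chartη_extChartAt_apply hz a).symm
  have hd := S.differentiableAt_chartη y
  have hd' : DifferentiableAt ℝ (fun e => S.chartη y e a) (extChartAt 𝓘(ℝ, E) y y) :=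
    hd.clm_apply (differentiableAt_const a)
  have h : mfderiv 𝓘(ℝ, E) 𝓘(ℝ, ℝ) (fun z => S.η z (chartConstField y a z)) y
      = (mfderiv 𝓘(ℝ, E) 𝓘(ℝ, ℝ) (fun e => S.chartη y e a) (extChartAt 𝓘(ℝ, E) y y)).comp
        (mfderiv 𝓘(ℝ, E) 𝓘(ℝ, E) (extChartAt 𝓘(ℝ, E) y) y) := by
    rw [heq.mfderiv_eq]
    exact mfderiv_comp y hd'.mdifferentiableAt
      ((contMDiffAt_extChartAt (n := 1)).mdifferentiableAt one_ne_zero)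
  have h' := congrArg (fun k : E →L[ℝ] ℝ => k v) h
  refine h'.trans ?_
  rw [mfderiv_eq_fderiv, fderiv_clm_apply hd (differentiableAt_const a)]
  simp
  rfl

/-- The bracket term drops out; the factor 1/2 is the one in the convention for `dη`. -/
theorem dη_chartConstField [FiniteDimensional ℝ E] (y : N) (a b : E) :
    S.dη (chartConstField y a) (chartConstField y b) y
      = (fderiv ℝ (S.chartη y) (extChartAt 𝓘(ℝ, E) y y) a b
        - fderiv ℝ (S.chartη y) (extChartAt 𝓘(ℝ, E) y y) b a) / 2 := by
  rw [dη, mlieBracket_chartConstField, mvfderiv_η_chartConstField, mvfderiv_η_chartConstField,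
    mfderiv_extChartAt_chartConstField (mem_extChartAt_source y),
    mfderiv_extChartAt_chartConstField (mem_extChartAt_source y)]
  simp

variable {S}

/-- A contact metric structure pairs trivially, through `g(·, φ ·)`, two vectors tangent to a
submanifold on which `η` vanishes. -/
theorem IsSasakian.inner_φ_eq_zero_of_η_eq_zero [FiniteDimensional ℝ E] (hS : S.IsSasakian)
    {E' : Type*} [NormedAddCommGroup E'] [NormedSpace ℝ E']
    {L : Type*} [TopologicalSpace L] [ChartedSpace E' L] [IsManifold 𝓘(ℝ, E') ∞ L]
    {j : L → N} (hj : ContMDiff 𝓘(ℝ, E') 𝓘(ℝ, E) ∞ j)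
    (h : ∀ q (v : TangentSpace 𝓘(ℝ, E') q), S.η (j q) (mfderiv 𝓘(ℝ, E') 𝓘(ℝ, E) j q v) = 0)
    (q : L) (v w : TangentSpace 𝓘(ℝ, E') q) :
    S.g.inner (j q) (mfderiv 𝓘(ℝ, E') 𝓘(ℝ, E) j q v)
      (S.φ (j q) (mfderiv 𝓘(ℝ, E') 𝓘(ℝ, E) j q w)) = 0 := by
  set c := extChartAt 𝓘(ℝ, E) (j q) with hc
  set d := extChartAt 𝓘(ℝ, E') q with hd
  set F : E' → E := fun e => c (j (d.symm e)) with hF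
  have hdq : d.symm (d q) = q := extChartAt_to_inv q
  have hsymm : ∀ e ∈ d.target, ContMDiffAt 𝓘(ℝ, E') 𝓘(ℝ, E') ∞ d.symm e := fun e he =>
    (contMDiffOn_extChartAt_symm q).contMDiffAt ((isOpen_extChartAt_target q).mem_nhds he)
  have hFsmooth : ContDiffAt ℝ 2 F (d q) := by
    rw [← contMDiffAt_iff_contDiffAt]
    have h1 : ContMDiffAt 𝓘(ℝ, E') 𝓘(ℝ, E) ∞ (c ∘ j) q :=
      contMDiffAt_extChartAt.comp q hj.contMDiffAt
    exact (h1.comp_of_eq (hsymm _ (mem_extChartAt_target q)) hdq).of_le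
      (WithTop.coe_le_coe.2 (le_top : (2 : ℕ∞) ≤ ⊤))
  have hnear : ∀ᶠ e in 𝓝 (d q), e ∈ d.target ∧ j (d.symm e) ∈ c.source := by
    have hcont : ContinuousAt (fun e => j (d.symm e)) (d q) :=
      hj.continuous.continuousAt.comp (continuousAt_extChartAt_symm q)
    refine Filter.Eventually.and (extChartAt_target_mem_nhds q) (hcont ?_)
    simp only [hdq]
    exact extChartAt_source_mem_nhds (j q)
  -- The point `q'` is kept separate from `d.symm e` so that `q` itself can be substituted at `e = d
  -- q`, avoiding a transport between tangent spaces.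
  have hderiv {e : E'} {q' : L} (hq' : d.symm e = q') (he : e ∈ d.target ∧ j q' ∈ c.source)
      (u : E') : fderiv ℝ F e u = (mfderiv 𝓘(ℝ, E) 𝓘(ℝ, E) c (j q') : E →L[ℝ] E)
        ((mfderiv 𝓘(ℝ, E') 𝓘(ℝ, E) j q' : E' →L[ℝ] E)
          ((mfderiv 𝓘(ℝ, E') 𝓘(ℝ, E') d.symm e : E' →L[ℝ] E') u)) := by
    subst hq'
    have hm1 : MDifferentiableAt 𝓘(ℝ, E') 𝓘(ℝ, E') d.symm e :=
      (hsymm e he.1).mdifferentiableAt (by simp)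
    have hm2 : MDifferentiableAt 𝓘(ℝ, E') 𝓘(ℝ, E) j (d.symm e) :=
      hj.contMDiffAt.mdifferentiableAt (by simp)
    have hm3 : MDifferentiableAt 𝓘(ℝ, E) 𝓘(ℝ, E) c (j (d.symm e)) :=
      mdifferentiableAt_extChartAt (by simpa [hc] using he.2)
    rw [← mfderiv_eq_fderiv]
    have e1 := mfderiv_comp e hm3 (hm2.comp e hm1)
    have e2 := mfderiv_comp e hm2 hm1
    have e3 := congrArg (fun k : E' →L[ℝ] E => k u) e1
    refine e3.trans ?_
    rw [e2]
    rfl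
  have hzero : ∀ᶠ e in 𝓝 (d q), ∀ u, S.chartη (j q) (F e) (fderiv ℝ F e u) = 0 := by
    filter_upwards [hnear] with e he u
    rw [hderiv rfl he]
    refine (S.chartη_extChartAt_apply he.2 _).trans ?_
    refine (congrArg (S.η (j (d.symm e))) (chartConstField_mfderiv_extChartAt he.2 _)).trans ?_
    exact h _ _
  have hFq : F (d q) = c (j q) := by rw [hF]; simp only [hdq]
  have hdiff : DifferentiableAt ℝ (S.chartη (j q)) (F (d q)) := by
    rw [hFq]; exact S.differentiableAt_chartη (j q)
  -- The chart coordinates `a` of `dj(u)` serve twice: they lie in the image of `DF`, via `u' =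
  -- dd(u)`, and their constant field takes the value `dj(u)` at `j q`.
  have hlift (u : TangentSpace 𝓘(ℝ, E') q) : ∃ a : E, ∃ u' : E', fderiv ℝ F (d q) u' = a ∧
      chartConstField (j q) a (j q) = mfderiv 𝓘(ℝ, E') 𝓘(ℝ, E) j q u := by
    refine ⟨mfderiv 𝓘(ℝ, E) 𝓘(ℝ, E) c (j q) (mfderiv 𝓘(ℝ, E') 𝓘(ℝ, E) j q u),
      mfderiv 𝓘(ℝ, E') 𝓘(ℝ, E') d q u, ?_,
      chartConstField_mfderiv_extChartAt (mem_extChartAt_source (j q)) _⟩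
    have h1 := mfderivWithin_extChartAt_symm_comp_mfderiv_extChartAt' (I := 𝓘(ℝ, E'))
      (mem_extChartAt_source (I := 𝓘(ℝ, E')) q)
    rw [modelWithCornersSelf_coe, Set.range_id, mfderivWithin_univ] at h1
    have h2 : (mfderiv 𝓘(ℝ, E') 𝓘(ℝ, E') d.symm (d q) : E' →L[ℝ] E')
        ((mfderiv 𝓘(ℝ, E') 𝓘(ℝ, E') d q : E' →L[ℝ] E') u) = u :=
      congrArg (fun k : E' →L[ℝ] E' => k u) h1
    refine (hderiv hdq ⟨mem_extChartAt_target q, mem_extChartAt_source (j q)⟩ _).trans ?_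
    rw [h2]
  obtain ⟨a, v', hv', ha⟩ := hlift v
  obtain ⟨b, w', hw', hb⟩ := hlift w
  have hcomm := fderiv_apply_comm_of_pullback_eq_zero hFsmooth hdiff hzero v' w'
  rw [hFq, hv', hw'] at hcomm
  have hcontact := hS.contact (j q) _ _ (smoothFieldAt_chartConstField (j q) a)
    (smoothFieldAt_chartConstField (j q) b)
  rw [dη_chartConstField, ha, hb] at hcontact
  rw [← hcontact, hcomm, sub_self, zero_div]

end AlmostContactMetric

end

/-! ### Pointwise algebra of the structure tensors -/

namespace AlmostContactMetric

variable {E H : Type*} [NormedAddCommGroup E] [NormedSpace ℝ E] [TopologicalSpace H]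
  {I : ModelWithCorners ℝ E H} {N : Type*} [TopologicalSpace N] [ChartedSpace H N]
  [IsManifold I ∞ N] (S : AlmostContactMetric I N)

/-- Since `φ²ξ = -ξ + ξ = 0`, compatibility applied to `φξ` gives `0 = |φξ|²`, because `η ∘ φ = 0`.
-/
theorem φ_ξ (x : N) : S.φ x (S.ξ x) = 0 := by
  have h2 : S.φ x (S.φ x (S.ξ x)) = 0 := by rw [S.φ_sq, S.η_ξ, one_smul, neg_add_cancel]
  have h := S.compat x (S.φ x (S.ξ x)) (S.φ x (S.ξ x))
  rw [h2, map_zero, S.η_φ, mul_zero, sub_zero] at h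
  by_contra hne
  exact (S.g.pos x _ hne).ne h

theorem η_eq_inner_ξ (x : N) (v : TangentSpace I x) : S.η x v = S.g.inner x (S.ξ x) v := by
  have h := S.compat x (S.ξ x) v
  rw [φ_ξ, map_zero, S.η_ξ, one_mul] at h
  exact (sub_eq_zero.1 h.symm).symm

end AlmostContactMetric

/-! ### Leaves and fibres of the warped product -/

section

variable {E H : Type*} [NormedAddCommGroup E] [NormedSpace ℝ E] [TopologicalSpace H]
  {I : ModelWithCorners ℝ E H} {N : Type*} [TopologicalSpace N] [ChartedSpace H N]

variable {E₁ H₁ : Type*} [NormedAddCommGroup E₁] [NormedSpace ℝ E₁] [TopologicalSpace H₁]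
  {I₁ : ModelWithCorners ℝ E₁ H₁} {M₁ : Type*} [TopologicalSpace M₁] [ChartedSpace H₁ M₁]
  {E₂ H₂ : Type*} [NormedAddCommGroup E₂] [NormedSpace ℝ E₂] [TopologicalSpace H₂]
  {I₂ : ModelWithCorners ℝ E₂ H₂} {M₂ : Type*} [TopologicalSpace M₂] [ChartedSpace H₂ M₂]

theorem mfderiv_fibre_apply {ι : M₁ × M₂ → N} (hι : ContMDiff (I₁.prod I₂) I ∞ ι) (p : M₁) (q : M₂)
    (v : TangentSpace I₂ q) :
    mfderiv I₂ I (fun q => ι (p, q)) q v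
      = mfderiv (I₁.prod I₂) I ι (p, q) ((0, v) : E₁ × E₂) := by
  have h1 : MDifferentiableAt (I₁.prod I₂) I ι (p, q) := hι.mdifferentiableAt (by simp)
  have h2 : MDifferentiableAt I₂ (I₁.prod I₂) (fun q : M₂ => (p, q)) q :=
    mdifferentiableAt_const.prodMk mdifferentiableAt_id
  have h3 := mfderiv_comp q h1 h2
  rw [mfderiv_prod_right] at h3
  exact congrArg (fun k : E₂ →L[ℝ] E => k v) h3

theorem mfderiv_leaf_apply {ι : M₁ × M₂ → N} (hι : ContMDiff (I₁.prod I₂) I ∞ ι) (p : M₁) (q : M₂)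
    (u : TangentSpace I₁ p) :
    mfderiv I₁ I (fun p => ι (p, q)) p u
      = mfderiv (I₁.prod I₂) I ι (p, q) ((u, 0) : E₁ × E₂) := by
  have h1 : MDifferentiableAt (I₁.prod I₂) I ι (p, q) := hι.mdifferentiableAt (by simp)
  have h2 : MDifferentiableAt I₁ (I₁.prod I₂) (fun p : M₁ => (p, q)) p :=
    mdifferentiableAt_id.prodMk mdifferentiableAt_const
  have h3 := mfderiv_comp p h1 h2
  rw [mfderiv_prod_left] at h3
  exact congrArg (fun k : E₁ →L[ℝ] E => k u) h3

variable [IsManifold I ∞ N] [IsManifold I₁ ∞ M₁] [IsManifold I₂ ∞ M₂]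

/-- A vector is at angle `π / 2` to a nontrivial subspace orthogonal to it. -/
theorem SmoothMetric.angleSubspace_eq_pi_div_two (g : SmoothMetric I N) (x : N)
    (u : TangentSpace I x) (W : Submodule ℝ (TangentSpace I x))
    (h : ∀ w ∈ W, g.inner x u w = 0) (hW : ∃ w ∈ W, w ≠ 0) :
    SmoothMetric.angleSubspace g x u W = Real.pi / 2 := by
  -- A nonzero `w` is needed: for trivial `W` the set would be empty, and its `sInf` would be `0`.
  have hset : {a : ℝ | ∃ w ∈ W, w ≠ 0 ∧ a = SmoothMetric.angle g x u w} = {Real.pi / 2} := by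
    ext a
    simp only [Set.mem_ofPred_eq, Set.mem_singleton_iff]
    constructor
    · rintro ⟨w, hw, -, rfl⟩
      rw [SmoothMetric.angle, h w hw, zero_div, Real.arccos_zero]
    · rintro rfl
      obtain ⟨w, hw, hw0⟩ := hW
      exact ⟨w, hw, hw0, by rw [SmoothMetric.angle, h w hw, zero_div, Real.arccos_zero]⟩
  rw [SmoothMetric.angleSubspace, hset, csInf_singleton]

variable {S : AlmostContactMetric I N} {g₁ : SmoothMetric I₁ M₁} {g₂ : SmoothMetric I₂ M₂}
  {f : M₁ → ℝ} {g : SmoothMetric (I₁.prod I₂) (M₁ × M₂)} {ι : M₁ × M₂ → N}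

namespace IsWarpedInvariantBase

/-- Each summand of the warped metric sees a zero component: the fibre vector dies in the first, the
leaf vector in the second. -/
theorem inner_leaf_fibre (h : IsWarpedInvariantBase S g₁ g₂ f g ι) (p : M₁) (q : M₂)
    (u : TangentSpace I₁ p) (v : TangentSpace I₂ q) :
    S.g.inner (ι (p, q)) (mfderiv I₁ I (fun p => ι (p, q)) p u)
      (mfderiv I₂ I (fun q => ι (p, q)) q v) = 0 := by
  rw [mfderiv_leaf_apply h.immersion.smooth, mfderiv_fibre_apply h.immersion.smooth]
  refine (h.immersion.isometric (p, q) ((u, 0) : E₁ × E₂) ((0, v) : E₁ × E₂)).trans ?_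
  refine (h.warped.inner_eq (p, q) ((u, 0) : E₁ × E₂) ((0, v) : E₁ × E₂)).trans ?_
  have h1 : mfderiv (I₁.prod I₂) I₁ Prod.fst (p, q) ((0, v) : E₁ × E₂) = 0 := by
    rw [mfderiv_fst]; rfl
  have h2 : mfderiv (I₁.prod I₂) I₂ Prod.snd (p, q) ((u, 0) : E₁ × E₂) = 0 := by
    rw [mfderiv_snd]; rfl
  rw [h1, h2, map_zero, map_zero]
  simp

theorem η_fibre (h : IsWarpedInvariantBase S g₁ g₂ f g ι) (p : M₁) (q : M₂)
    (v : TangentSpace I₂ q) :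
    S.η (ι (p, q)) (mfderiv I₂ I (fun q => ι (p, q)) q v) = 0 := by
  obtain ⟨u, hu⟩ := h.ξ_tangent p q
  rw [S.η_eq_inner_ξ]
  rw [← hu]
  exact h.inner_leaf_fibre p q u v

/-- An isometric map has injective derivative, by positivity of `g`. -/
theorem mfderiv_fibre_ne_zero (h : IsWarpedInvariantBase S g₁ g₂ f g ι) (p : M₁) (q : M₂)
    {v : TangentSpace I₂ q} (hv : v ≠ 0) : mfderiv I₂ I (fun q => ι (p, q)) q v ≠ 0 := by
  rw [mfderiv_fibre_apply h.immersion.smooth]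
  intro h0
  have hpos := g.pos (p, q) ((0, v) : E₁ × E₂) fun hz => hv (congrArg Prod.snd hz)
  have hiso := h.immersion.isometric (p, q) ((0, v) : E₁ × E₂) ((0, v) : E₁ × E₂)
  rw [h0, map_zero] at hiso
  exact hpos.ne hiso

end IsWarpedInvariantBase

end

/-! ### Anti-invariance of the fibres and the slant angle -/

section

variable {E : Type*} [NormedAddCommGroup E] [NormedSpace ℝ E] [FiniteDimensional ℝ E]
  {N : Type*} [TopologicalSpace N] [ChartedSpace E N] [IsManifold 𝓘(ℝ, E) ∞ N]
  {E₁ : Type*} [NormedAddCommGroup E₁] [NormedSpace ℝ E₁]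
  {M₁ : Type*} [TopologicalSpace M₁] [ChartedSpace E₁ M₁] [IsManifold 𝓘(ℝ, E₁) ∞ M₁]
  {E₂ : Type*} [NormedAddCommGroup E₂] [NormedSpace ℝ E₂]
  {M₂ : Type*} [TopologicalSpace M₂] [ChartedSpace E₂ M₂] [IsManifold 𝓘(ℝ, E₂) ∞ M₂]
  {S : AlmostContactMetric 𝓘(ℝ, E) N}
  {g₁ : SmoothMetric 𝓘(ℝ, E₁) M₁} {g₂ : SmoothMetric 𝓘(ℝ, E₂) M₂}
  {f : M₁ → ℝ} {g : SmoothMetric (𝓘(ℝ, E₁).prod 𝓘(ℝ, E₂)) (M₁ × M₂)} {ι : M₁ × M₂ → N}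

/-- In a Sasakian manifold, the fibres of a warped product whose leaves are tangent to `ξ` are
anti-invariant. -/
theorem IsWarpedInvariantBase.isAntiInvariantSubmanifold
    (h : IsWarpedInvariantBase S g₁ g₂ f g ι) (hS : S.IsSasakian) (p : M₁) :
    IsAntiInvariantSubmanifold 𝓘(ℝ, E₂) S (fun q : M₂ => ι (p, q)) := by
  rintro q _ ⟨u, rfl⟩ _ ⟨w, rfl⟩
  have hj : ContMDiff 𝓘(ℝ, E₂) 𝓘(ℝ, E) ∞ (fun q : M₂ => ι (p, q)) :=
    h.immersion.smooth.comp (contMDiff_const.prodMk contMDiff_id)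
  rw [S.g.symm]
  exact hS.inner_φ_eq_zero_of_η_eq_zero hj (fun q v => h.η_fibre p q v) q w u

/-- In a Sasakian manifold, the slant function of a warped product pointwise semi-slant submanifold
whose leaves are tangent to `ξ` is `π / 2`. -/
theorem IsWarpedPointwiseSemiSlant.slant_eq_pi_div_two [Nontrivial E₂] {θ : M₁ × M₂ → ℝ}
    (h : IsWarpedPointwiseSemiSlant S g₁ g₂ f g ι θ) (hS : S.IsSasakian) (x : M₁ × M₂) :
    θ x = Real.pi / 2 := by
  obtain ⟨p, q⟩ := x
  obtain ⟨v, hv⟩ := exists_ne (0 : E₂)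
  have hne := h.mfderiv_fibre_ne_zero p q (v := v) hv
  set u := mfderiv 𝓘(ℝ, E₂) 𝓘(ℝ, E) (fun q : M₂ => ι (p, q)) q v with hu
  have humem : u ∈ tangentRange 𝓘(ℝ, E₂) 𝓘(ℝ, E) (fun q : M₂ => ι (p, q)) q := ⟨v, rfl⟩
  -- If `u = cξ`, then `c = η(u) = 0`, contradicting `u ≠ 0`; so the slant condition applies to `u`.
  have huξ : u ∉ Submodule.span ℝ {S.ξ (ι (p, q))} := by
    rw [Submodule.mem_span_singleton]
    rintro ⟨c, hc⟩
    have hη : S.η (ι (p, q)) u = 0 := h.η_fibre p q v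
    rw [← hc, map_smul, S.η_ξ, smul_eq_mul, mul_one] at hη
    rw [hη, zero_smul] at hc
    exact hne hc.symm
  refine (h.slant p q u humem huξ).symm.trans ?_
  exact SmoothMetric.angleSubspace_eq_pi_div_two _ _ _ _
    (fun w hw => h.isAntiInvariantSubmanifold hS p q u humem w hw) ⟨u, humem, hne⟩

end

theorem theorem4
    {E : Type*} [NormedAddCommGroup E] [NormedSpace ℝ E] [FiniteDimensional ℝ E]
    {N : Type*} [TopologicalSpace N] [ChartedSpace E N] [IsManifold 𝓘(ℝ, E) ∞ N]
    {E₁ : Type*} [NormedAddCommGroup E₁] [NormedSpace ℝ E₁] [FiniteDimensional ℝ E₁]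
    {MT : Type*} [TopologicalSpace MT] [ChartedSpace E₁ MT] [IsManifold 𝓘(ℝ, E₁) ∞ MT]
    {E₂ : Type*} [NormedAddCommGroup E₂] [NormedSpace ℝ E₂] [FiniteDimensional ℝ E₂]
    [Nontrivial E₂]
    {Mθ : Type*} [TopologicalSpace Mθ] [ChartedSpace E₂ Mθ] [IsManifold 𝓘(ℝ, E₂) ∞ Mθ]
    (S : AlmostContactMetric 𝓘(ℝ, E) N) (hS : S.IsSasakian)
    (gT : SmoothMetric 𝓘(ℝ, E₁) MT) (gθ : SmoothMetric 𝓘(ℝ, E₂) Mθ) (f : MT → ℝ)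
    (g : SmoothMetric (𝓘(ℝ, E₁).prod 𝓘(ℝ, E₂)) (MT × Mθ))
    (ι : MT × Mθ → N) (θ : MT × Mθ → ℝ)
    (hM : IsWarpedPointwiseSemiSlant S gT gθ f g ι θ) :
    (IsContactCRWarped S gT gθ f g ι ∧ ∀ x : MT × Mθ, θ x = Real.pi / 2) ∨
    (∀ x : MT × Mθ,
      Real.cos (θ x) ≠ 0 ∧
      MDifferentiableAt (𝓘(ℝ, E₁).prod 𝓘(ℝ, E₂)) 𝓘(ℝ, ℝ) θ x ∧
      (∀ X : TangentSpace 𝓘(ℝ, E₁) x.1,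
        mvfderiv 𝓘(ℝ, E₁) (fun p => Real.log (f p)) x.1 X
          = Real.tan (θ x) * mvfderiv 𝓘(ℝ, E₁) (fun p => θ (p, x.2)) x.1 X) ∧
      SmoothMetric.grad g (fun y => Real.log (f y.1)) x
        = Real.tan (θ x) • SmoothMetric.grad g θ x) := by
  exact Or.inl ⟨⟨hM.toIsWarpedInvariantBase, hM.isAntiInvariantSubmanifold hS⟩,
    hM.slant_eq_pi_div_two hS⟩
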